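/- Let $\theta$ denote entrywise complex conjugation on $\mathbb{C}^N$ and on $\mathbb{C}^D$; thus $\theta M\theta=\overline{M}$ for a matrix $M$. Let $\beta:\mathbb{R}\to M_N(\mathbb{C})$ be a continuous family of unitary matrices which is $\mathbb{Z}$-periodic and has the $CS'$ symmetry $\theta\beta(k)\theta=\beta(-k)^{-1}$ (equivalently ${}^t\beta(k)=\beta(-k)$) for all $k\in\mathbb{R}$. Call a family $h:\mathbb{R}\to M_N(\mathbb{C})$ good if it is continuous, $\mathbb{Z}$-periodic, self-adjoint, and satisfies $\theta h(k)\theta=h(-k)$ for all $k$. Then there is a family of unitary matrices $u(x,k_2)$, continuous on $[-\tfrac12,\tfrac12]\times\mathbb{R}$ and $\mathbb{Z}$-periodic in $k_2$, such that $$[u(-\tfrac12,k_2)]^{-1}\,\beta(k_2)\,u(\tfrac12,k_2)=\mathrm{Id}\qquad\text{and}\qquad \theta u(x,k_2)\theta=u(-x,-k_2)$$ for all $x\in[-\tfrac12,\tfrac12]$ and $k_2\in\mathbb{R}$. It can be chosen of the form $$u(x,k_2)=e^{-ix\,h(k_2)}\,e^{-ix\,\tilde h(k_2)},$$ where $h$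 and $\tilde h$ are good families, $\tilde\beta(k_2):=e^{-\frac i2 h(k_2)}\beta(k_2)e^{-\frac i2 h(k_2)}$ satisfies $\|\tilde\beta(k_2)-\mathrm{Id}\|\le\tfrac12$ (operator norm) for all $k_2$, and $\tilde h$ is a logarithm of $\tilde\beta$: $\tilde\beta(k_2)=e^{i\tilde h(k_2)}$ for all $k_2$. Moreover, let $D\ge 0$ and let $P(x,k_2)$, $(x,k_2)\in[-\tfrac12,\tfrac12]\times\mathbb{R}$, be orthogonal projections in $\mathbb{C}^D$. Let $\Psi_1,\dots,\Psi_N:[-\tfrac12,\tfrac12]\times\mathbb{R}\to\mathbb{C}^D$ be continuous and $\mathbb{Z}$-periodic in $k_2$, form an orthonormal basis of $\mathrm{Ran}\,P(x,k_2)$ at every point, and satisfy $\theta\Psi_n(x,k_2)=\Psi_n(-x,-k_2)$ and $$\Psi_m(\tfrac12,k_2)=\sum_{n=1}^N[\beta(k_2)]_{nm}\,\Psi_n(-\tfrac12,k_2).$$ Then the vectors $\widetilde\Xi_m(x,k_2):=\sum_{n=1}^N[u(x,k_2)]_{nm}\Psi_n(x,k_2)$ are continuous on $[-\tfrac12,\tfrac12]\times\mathbb{R}$,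 $\mathbb{Z}$-periodic in $k_2$, form an orthonormal basis of $\mathrm{Ran}\,P(x,k_2)$ at every point, and satisfy $\theta\widetilde\Xi_m(x,k_2)=\widetilde\Xi_m(-x,-k_2)$ and $\widetilde\Xi_m(-\tfrac12,k_2)=\widetilde\Xi_m(\tfrac12,k_2)$. -/

import Mathlib

open Matrix Set

/-- The matrix of `θ M θ`, where `θ` is the complex conjugation of `ℂ^N`: all entries are
conjugated. -/
def conjMatrix {N : ℕ} (M : Matrix (Fin N) (Fin N) ℂ) : Matrix (Fin N) (Fin N) ℂ :=
  M.map (starRingEnd ℂ)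

/-- `conjMatrix M` does represent `θ M θ`. -/
theorem conjMatrix_mulVec {N : ℕ} (M : Matrix (Fin N) (Fin N) ℂ) (v : Fin N → ℂ) :
    conjMatrix M *ᵥ v = star (M *ᵥ star v) := by
  ext i
  simp [conjMatrix, Matrix.mulVec, dotProduct]

/-- The `CS` symmetry `θ α(k) θ = α(-k)`. -/
def HasCS {N : ℕ} (α : ℝ → Matrix (Fin N) (Fin N) ℂ) : Prop :=
  ∀ k, conjMatrix (α k) = α (-k)

/-- The `CS'` symmetry `θ β(k) θ = β(-k)⁻¹`. -/
def HasCSPrime {N : ℕ} (β : ℝ → Matrix (Fin N) (Fin N) ℂ) : Prop :=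
  ∀ k, conjMatrix (β k) = (β (-k))⁻¹

/-- For unitary families the `CS'` symmetry says that the transpose of `β(k)` is `β(-k)`. -/
theorem hasCSPrime_iff_transpose {N : ℕ} (β : ℝ → Matrix (Fin N) (Fin N) ℂ)
    (hβ : ∀ k, β k ∈ Matrix.unitaryGroup (Fin N) ℂ) :
    HasCSPrime β ↔ ∀ k, (β k)ᵀ = β (-k) := by
  have hinv : ∀ k, (β k)⁻¹ = (β k)ᴴ := fun k =>
    Matrix.inv_eq_left_inv (Matrix.mem_unitaryGroup_iff'.mp (hβ k))
  have hc : ∀ M : Matrix (Fin N) (Fin N) ℂ, conjMatrix M = (Mᵀ)ᴴ := fun M => by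
    ext i j
    simp [conjMatrix]
  refine forall_congr' fun k => ?_
  rw [hinv, hc]
  exact Matrix.conjTranspose_inj

/-- A continuous, `ℤ`-periodic family of unitary matrices with the `CS'` symmetry. -/
structure IsMatchingFamily {N : ℕ} (β : ℝ → Matrix (Fin N) (Fin N) ℂ) : Prop where
  unitary : ∀ k, β k ∈ Matrix.unitaryGroup (Fin N) ℂ
  continuous : Continuous β
  periodic : Function.Periodic β 1
  csPrime : HasCSPrime β

/-- A continuous, `ℤ`-periodic family of self-adjoint matrices with the `CS` symmetry. -/
structure IsGoodFamily {N : ℕ} (h : ℝ → Matrix (Fin N) (Fin N) ℂ) : Prop where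
  selfAdjoint : ∀ k, (h k).IsHermitian
  continuous : Continuous h
  periodic : Function.Periodic h 1
  cs : HasCS h

/-- `h` is a good logarithm of `β`: a good family with `β(k) = e^{i h(k)}`. -/
def IsGoodLogarithm {N : ℕ} (h β : ℝ → Matrix (Fin N) (Fin N) ℂ) : Prop :=
  IsGoodFamily h ∧ ∀ k, β k = NormedSpace.exp (Complex.I • h k)

/-- The family `e^{-(i/2) h(k)} β(k) e^{-(i/2) h(k)}`. -/
noncomputable def rotatedFamily {N : ℕ} (h β : ℝ → Matrix (Fin N) (Fin N) ℂ) (k : ℝ) :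
    Matrix (Fin N) (Fin N) ℂ :=
  NormedSpace.exp ((-(Complex.I / 2)) • h k) * β k * NormedSpace.exp ((-(Complex.I / 2)) • h k)

/-- The operator norm of a matrix acting on the Euclidean space `ℂ^N`. -/
noncomputable def matrixOpNorm {N : ℕ} (M : Matrix (Fin N) (Fin N) ℂ) : ℝ :=
  ‖Matrix.toEuclideanCLM (n := Fin N) (𝕜 := ℂ) M‖

/-- The strip `[-1/2, 1/2] × ℝ`. -/
def strip : Set (ℝ × ℝ) := Icc (-(1 / 2) : ℝ) (1 / 2) ×ˢ univ

/-- Complex conjugation of vectors in `ℂ^D`. -/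
def conjVec {D : ℕ} (v : EuclideanSpace ℂ (Fin D)) : EuclideanSpace ℂ (Fin D) :=
  WithLp.toLp 2 fun i => starRingEnd ℂ (v i)

/-- On the strip, the vectors `Ψ_n(x, k)` form an orthonormal basis of the range of `P(x, k)`,
are continuous, `ℤ`-periodic in `k`, and have the symmetry `θ Ψ_n(x, k) = Ψ_n(-x, -k)`. -/
structure IsCSFrame {D N : ℕ}
    (P : ℝ → ℝ → EuclideanSpace ℂ (Fin D) →L[ℂ] EuclideanSpace ℂ (Fin D))
    (Ψ : Fin N → ℝ → ℝ → EuclideanSpace ℂ (Fin D)) : Prop where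
  orthonormal : ∀ p ∈ strip, Orthonormal ℂ fun n => Ψ n p.1 p.2
  span_eq : ∀ p ∈ strip, Submodule.span ℂ (range fun n => Ψ n p.1 p.2) =
    LinearMap.range (P p.1 p.2 : EuclideanSpace ℂ (Fin D) →ₗ[ℂ] EuclideanSpace ℂ (Fin D))
  continuousOn : ∀ n, ContinuousOn (fun p : ℝ × ℝ => Ψ n p.1 p.2) strip
  periodic : ∀ n, ∀ p ∈ strip, Ψ n p.1 (p.2 + 1) = Ψ n p.1 p.2
  cs : ∀ n, ∀ p ∈ strip, conjVec (Ψ n p.1 p.2) = Ψ n (-p.1) (-p.2)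

/-- The rotated vectors `∑ₙ u_{nm}(x, k) Ψ_n(x, k)`. -/
noncomputable def rotatedFrame {D N : ℕ} (u : ℝ → ℝ → Matrix (Fin N) (Fin N) ℂ)
    (Ψ : Fin N → ℝ → ℝ → EuclideanSpace ℂ (Fin D)) (m : Fin N) (x k : ℝ) :
    EuclideanSpace ℂ (Fin D) :=
  ∑ n, u x k n m • Ψ n x k

/-! If `β` had a good logarithm `h`, then `e^{-ixh}` would solve the matching problem. Eigenvectors
of `β` need not vary continuously where eigenvalues collide, so the logarithm is taken in two steps.
A good `h` with `e^{ih}` uniformly close to `β` makes `e^{-ih/2} β e^{-ih/2}` close to the identity,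
and the principal logarithm of that family is continuous and inherits the symmetry
(`exists_isGoodLogarithm`).

The approximation comes from the map `(U, l) ↦ U diag(e^{il}) U*`, with values in the unitary
matrices. Exact lifts of paths may fail to exist, but approximate ones do (`exists_approx_lift`): up
to permutations and `2π`-shifts of the eigenvalues, the fibres are path connected and a compact set
covers the source. At `k = 0` and `k = 1/2` the matrix `β(k)` is symmetric, so real eigenvectors can
be prescribed there. The Hermitian path over `[0, 1/2]` then has symmetric ends and extends by
`h(-k) = h(k)ᵀ` and periodicity to a good family (`exists_periodic_reflection`). -/

/-! ### Approximate path lifting modulo a group. -/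

/-- The points of `f ⁻¹' O` that can be joined to `x` modulo `G` form an open set `A` with open
complement `B` in `f ⁻¹' O`. Both are unions of fibres, so they would separate `C`; compactness of
`K` turns this into a separation by closed sets downstairs. -/
theorem exists_joinedIn_preimage_of_isPreconnected {X Y : Type*} [TopologicalSpace X]
    [LocallyPathConnectedSpace X] [TopologicalSpace Y] [T2Space Y] {f : X → Y} (hf : Continuous f)
    (G : Subgroup (X ≃ₜ X)) (hG : ∀ g ∈ G, ∀ x, f (g x) = f x)
    (hfib : ∀ x y, f x = f y → ∃ g ∈ G, JoinedIn (f ⁻¹' {f x}) x (g y))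
    {K : Set X} (hK : IsCompact K) (hGK : ∀ x, ∃ g ∈ G, g x ∈ K)
    {O C : Set Y} (hO : IsOpen O) (hC : IsPreconnected C) (hCO : C ⊆ O) (hCf : C ⊆ range f)
    {x y : X} (hx : f x ∈ C) (hy : f y ∈ C) :
    ∃ g ∈ G, JoinedIn (f ⁻¹' O) x (g y) := by
  set S := f ⁻¹' O with hS
  have hSo : IsOpen S := hO.preimage hf
  have hgS : ∀ g ∈ G, ∀ {z w}, JoinedIn S z w → JoinedIn S (g z) (g w) := by
    rintro g hg z w ⟨p, hp⟩
    refine ⟨p.map g.continuous, fun t => ?_⟩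
    simpa [hS, hG g hg] using hp t
  set A : Set X := {z | ∃ g ∈ G, JoinedIn S x (g z)} with hA
  have hAo : IsOpen A := by
    have : A = ⋃ g ∈ G, g ⁻¹' (pathComponentIn S x) := by
      ext z; simp [hA, pathComponentIn]
    rw [this]
    exact isOpen_biUnion fun g _ => (hSo.pathComponentIn x).preimage g.continuous
  have hAS : A ⊆ S := by
    rintro z ⟨g, hg, h⟩
    simpa [hS, hG g hg] using h.target_mem
  set B : Set X := S \ A with hB
  have hBo : IsOpen B := by
    rw [isOpen_iff_mem_nhds]
    rintro z ⟨hzS, hzA⟩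
    filter_upwards [(hSo.pathComponentIn z).mem_nhds (mem_pathComponentIn_self hzS)] with w hw
    refine ⟨pathComponentIn_subset hw, ?_⟩
    rintro ⟨g, hg, h⟩
    exact hzA ⟨g, hg, h.trans (hgS g hg (JoinedIn.symm hw))⟩
  have hsat : ∀ z w, z ∈ A → f z = f w → w ∈ A := by
    intro z w hz hzw
    have hzS := hAS hz
    obtain ⟨g, hg, h⟩ := hz
    obtain ⟨g', hg', h'⟩ := hfib z w hzw
    refine ⟨g * g', G.mul_mem hg hg', h.trans (hgS g hg (h'.mono ?_))⟩
    rintro v hv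
    rw [mem_preimage, mem_singleton_iff] at hv
    rw [hS, mem_preimage, hv]
    exact hzS
  have hgA : ∀ g ∈ G, ∀ z, g z ∈ A ↔ z ∈ A := fun g hg z =>
    ⟨fun h => hsat _ _ h (hG g hg z), fun h => hsat _ _ h (hG g hg z).symm⟩
  suffices hyA : y ∈ A from hyA
  by_contra hyA
  -- Over `C ⊆ O`, lying outside `B` means lying in `A`. Since `K` meets every `G`-orbit, the two
  -- closed images cover `C`; a common point would have one preimage in `A` and one outside.
  have hZ1 : IsClosed (f '' (K ∩ Bᶜ)) := ((hK.inter_right hBo.isClosed_compl).image hf).isClosed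
  have hZ2 : IsClosed (f '' (K ∩ Aᶜ)) := ((hK.inter_right hAo.isClosed_compl).image hf).isClosed
  have hxA : x ∈ A := ⟨1, G.one_mem, JoinedIn.refl (hCO hx)⟩
  have key := isPreconnected_closed_iff.mp hC _ _ hZ1 hZ2 ?_ ?_ ?_
  · obtain ⟨c, hc, ⟨z₁, ⟨-, hz₁⟩, rfl⟩, ⟨z₂, ⟨-, hz₂⟩, h12⟩⟩ := key
    have hz₁A : z₁ ∈ A := by
      by_contra h
      exact hz₁ ⟨hCO hc, h⟩
    exact hz₂ (hsat _ _ hz₁A h12.symm)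
  · intro c hc
    obtain ⟨z, rfl⟩ := hCf hc
    obtain ⟨g, hg, hgz⟩ := hGK z
    by_cases hzA : z ∈ A
    · exact Or.inl ⟨g z, ⟨hgz, fun h => h.2 ((hgA g hg z).2 hzA)⟩, hG g hg z⟩
    · exact Or.inr ⟨g z, ⟨hgz, fun h => hzA ((hgA g hg z).1 h)⟩, hG g hg z⟩
  · obtain ⟨g, hg, hgx⟩ := hGK x
    exact ⟨f x, hx, g x, ⟨hgx, fun h => h.2 ((hgA g hg x).2 hxA)⟩, hG g hg x⟩
  · obtain ⟨g, hg, hgy⟩ := hGK y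
    exact ⟨f y, hy, g y, ⟨hgy, fun h => hyA ((hgA g hg y).1 h)⟩, hG g hg y⟩

/-- On a short interval `β` stays in a ball of radius `ε / 2`, and the previous lemma joins the ends
inside the preimage of that ball. The pieces are concatenated; both endpoints are prescribed, the
last one only up to `G`. -/
theorem exists_approx_lift {X Y : Type*} [TopologicalSpace X]
    [LocallyPathConnectedSpace X] [MetricSpace Y] {f : X → Y} (hf : Continuous f)
    (G : Subgroup (X ≃ₜ X)) (hG : ∀ g ∈ G, ∀ x, f (g x) = f x)
    (hfib : ∀ x y, f x = f y → ∃ g ∈ G, JoinedIn (f ⁻¹' {f x}) x (g y))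
    {K : Set X} (hK : IsCompact K) (hGK : ∀ x, ∃ g ∈ G, g x ∈ K)
    {β : ℝ → Y} (hβ : Continuous β) (hβf : ∀ t, β t ∈ range f) {ε : ℝ} (hε : 0 < ε)
    {b : ℝ} (hb : 0 < b) {x y : X} (hx : f x = β 0) (hy : f y = β b) :
    ∃ g ∈ G, ∃ γ : ℝ → X, Continuous γ ∧ γ 0 = x ∧ γ b = g y ∧
      ∀ t ∈ Icc 0 b, dist (f (γ t)) (β t) < ε := by
  obtain ⟨δ, hδ, hβδ⟩ := Metric.uniformContinuousOn_iff.mp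
    ((isCompact_Icc (a := (0 : ℝ)) (b := b)).uniformContinuousOn_of_continuous hβ.continuousOn)
    (ε / 2) (half_pos hε)
  have step : ∀ s t, 0 ≤ s → s < t → t ≤ b → t - s < δ → ∀ x y, f x = β s → f y = β t →
      ∃ g ∈ G, ∃ γ : ℝ → X, Continuous γ ∧ γ s = x ∧ γ t = g y ∧
        ∀ r ∈ Icc s t, dist (f (γ r)) (β r) < ε := by
    intro s t hs hst htb hstδ x y hx hy
    have hclose : ∀ r ∈ Icc s t, dist (β r) (β s) < ε / 2 := fun r hr =>
      hβδ r ⟨hs.trans hr.1, hr.2.trans htb⟩ s ⟨hs, hst.le.trans htb⟩ (by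
        rw [Real.dist_eq, abs_of_nonneg (sub_nonneg.2 hr.1)]
        linarith [hr.2])
    obtain ⟨g, hg, p, hp⟩ := exists_joinedIn_preimage_of_isPreconnected hf G hG hfib hK hGK
      (O := Metric.ball (β s) (ε / 2)) (C := β '' Icc s t) Metric.isOpen_ball
      (isPreconnected_Icc.image β hβ.continuousOn) (by
        rintro _ ⟨r, hr, rfl⟩; exact hclose r hr)
      (by rintro _ ⟨r, -, rfl⟩; exact hβf r) (x := x) (y := y)
      (hx ▸ mem_image_of_mem β (left_mem_Icc.2 hst.le))
      (hy ▸ mem_image_of_mem β (right_mem_Icc.2 hst.le))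
    refine ⟨g, hg, fun r => p.extend ((r - s) / (t - s)), ?_, by simp, ?_, fun r hr => ?_⟩
    · exact p.continuous_extend.comp (by fun_prop)
    · simp [div_self (sub_pos.2 hst).ne']
    · have h1 : f (p.extend ((r - s) / (t - s))) ∈ Metric.ball (β s) (ε / 2) := by
        have : p.extend ((r - s) / (t - s)) ∈ range p := by
          rw [← p.extend_range]; exact mem_range_self _
        obtain ⟨i, hi⟩ := this
        rw [← hi]; exact hp i
      have := dist_triangle_right (f (p.extend ((r - s) / (t - s)))) (β r) (β s)
      have h2 := hclose r hr
      rw [Metric.mem_ball] at h1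
      linarith
  obtain ⟨n, hn⟩ := exists_nat_gt (b / δ)
  have hn0 : (0 : ℝ) < n := (div_pos hb hδ).trans hn
  set τ := b / n with hτ
  have hτ0 : 0 < τ := div_pos hb hn0
  have hτδ : τ < δ := by
    rw [hτ, div_lt_iff₀ hn0]
    rw [div_lt_iff₀ hδ] at hn
    linarith
  have hnτ : n * τ = b := mul_div_cancel₀ b hn0.ne'
  -- The endpoint `y` stays universally quantified: the inductive step aims at an arbitrary preimage
  -- `z`, reaches `g₁ z`, and continues from there.
  have main : ∀ j : ℕ, j + 1 ≤ n → ∀ y, f y = β ((j + 1 : ℕ) * τ) →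
      ∃ g ∈ G, ∃ γ : ℝ → X, Continuous γ ∧ γ 0 = x ∧ γ ((j + 1 : ℕ) * τ) = g y ∧
        ∀ r ∈ Icc 0 ((j + 1 : ℕ) * τ), dist (f (γ r)) (β r) < ε := by
    have hle : ∀ j : ℕ, j ≤ n → j * τ ≤ b := fun j hj => by
      rw [← hnτ]; gcongr
    intro j
    induction j with
    | zero =>
      intro hj y hy
      have := hle _ hj
      simp only [zero_add, Nat.cast_one, one_mul] at hy this ⊢
      exact step 0 τ le_rfl hτ0 this (by simpa using hτδ) x y hx hy
    | succ j ih =>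
      intro hj y hy
      obtain ⟨z, hz⟩ := hβf ((j + 1 : ℕ) * τ)
      obtain ⟨g₁, hg₁, γ₁, hc₁, hs₁, ht₁, hd₁⟩ := ih (by omega) z hz
      have hlt : ((j + 1 : ℕ) : ℝ) * τ < (j + 1 + 1 : ℕ) * τ := by
        push_cast; nlinarith
      obtain ⟨g₂, hg₂, γ₂, hc₂, hs₂, ht₂, hd₂⟩ := step ((j + 1 : ℕ) * τ) ((j + 1 + 1 : ℕ) * τ)
        (by positivity) hlt (hle _ hj) (by push_cast; nlinarith) (g₁ z) y
        ((hG g₁ hg₁ z).trans hz) hy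
      refine ⟨g₂, hg₂, fun r => if r ≤ (j + 1 : ℕ) * τ then γ₁ r else γ₂ r, ?_, ?_, ?_, ?_⟩
      · refine Continuous.if_le hc₁ hc₂ continuous_id continuous_const ?_
        rintro r rfl
        exact ht₁.trans hs₂.symm
      · exact (if_pos (by positivity)).trans hs₁
      · exact (if_neg (not_le.2 hlt)).trans ht₂
      · intro r hr
        by_cases h : r ≤ (j + 1 : ℕ) * τ
        · simp only [if_pos h]; exact hd₁ r ⟨hr.1, h⟩
        · simp only [if_neg h]; exact hd₂ r ⟨(not_le.1 h).le, hr.2⟩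
  obtain ⟨m, rfl⟩ : ∃ m, n = m + 1 := Nat.exists_eq_succ_of_ne_zero (by
    rintro rfl; simp at hn0)
  have := main m le_rfl y (by rw [hnτ]; exact hy)
  rwa [hnτ] at this

/-! ### Logarithms of a single unitary matrix. -/

section Logarithm

open scoped Matrix.Norms.L2Operator
open Complex NormedSpace

variable {N : ℕ}

theorem conjMatrix_mul (M M' : Matrix (Fin N) (Fin N) ℂ) :
    conjMatrix (M * M') = conjMatrix M * conjMatrix M' := by
  simp [conjMatrix, Matrix.map_mul]

theorem conjMatrix_eq_transpose_conjTranspose (M : Matrix (Fin N) (Fin N) ℂ) :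
    conjMatrix M = Mᴴᵀ := by
  ext i j; simp [conjMatrix]

theorem Matrix.IsHermitian.conjMatrix_eq {M : Matrix (Fin N) (Fin N) ℂ} (hM : M.IsHermitian) :
    conjMatrix M = Mᵀ := by
  rw [conjMatrix_eq_transpose_conjTranspose, hM.eq]

theorem l2_opNorm_conjMatrix_le (M : Matrix (Fin N) (Fin N) ℂ) : ‖conjMatrix M‖ ≤ ‖M‖ := by
  rw [Matrix.cstar_norm_def (conjMatrix M)]
  refine ContinuousLinearMap.opNorm_le_bound _ (norm_nonneg _) fun v => ?_
  have h := Matrix.l2_opNorm_mulVec M (WithLp.toLp 2 (star v.ofLp))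
  have hstar : ∀ w : Fin N → ℂ, ‖WithLp.toLp 2 (star w)‖ = ‖WithLp.toLp 2 w‖ := fun w => by
    simp [EuclideanSpace.norm_eq]
  rw [hstar] at h
  calc ‖Matrix.toEuclideanCLM (n := Fin N) (𝕜 := ℂ) (conjMatrix M) v‖
      = ‖WithLp.toLp 2 (star (M *ᵥ star v.ofLp))‖ := by
        rw [← conjMatrix_mulVec]; rfl
    _ ≤ ‖M‖ * ‖v‖ := by rw [hstar]; exact h

/-- The self-adjoint logarithm of norm less than `π` is unique, and transposition preserves both
that bound and the exponential. -/
theorem argSelfAdjoint_transpose (V W : unitary (Matrix (Fin N) (Fin N) ℂ))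
    (hV : ‖(V : Matrix (Fin N) (Fin N) ℂ) - 1‖ < 2)
    (hVW : (W : Matrix (Fin N) (Fin N) ℂ) = (V : Matrix (Fin N) (Fin N) ℂ)ᵀ) :
    (Unitary.argSelfAdjoint W : Matrix (Fin N) (Fin N) ℂ) =
      (Unitary.argSelfAdjoint V : Matrix (Fin N) (Fin N) ℂ)ᵀ := by
  set H := Unitary.argSelfAdjoint V with hH
  have hHerm : (H : Matrix (Fin N) (Fin N) ℂ).IsHermitian := H.2
  have hHT : IsSelfAdjoint (H : Matrix (Fin N) (Fin N) ℂ)ᵀ := hHerm.transpose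
  set H' : selfAdjoint (Matrix (Fin N) (Fin N) ℂ) := ⟨(H : Matrix (Fin N) (Fin N) ℂ)ᵀ, hHT⟩ with hH'
  have hlt : ‖H‖ < Real.pi := by
    rw [Unitary.norm_argSelfAdjoint hV]
    calc Real.arccos (1 - ‖(V - 1 : Matrix (Fin N) (Fin N) ℂ)‖ ^ 2 / 2)
        < Real.arccos (1 - 2 ^ 2 / 2) := by
          apply Real.arccos_lt_arccos (by norm_num) (by gcongr)
          linarith [(by positivity : 0 ≤ ‖(V - 1 : Matrix (Fin N) (Fin N) ℂ)‖ ^ 2 / 2)]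
      _ = Real.pi := by norm_num
  have hlt' : ‖H'‖ < Real.pi := by
    refine lt_of_le_of_lt ?_ hlt
    have := l2_opNorm_conjMatrix_le (H : Matrix (Fin N) (Fin N) ℂ)
    rw [hHerm.conjMatrix_eq] at this
    exact this
  have hexp : selfAdjoint.expUnitary H' = W := by
    ext1
    have := congrArg (fun v : unitary (Matrix (Fin N) (Fin N) ℂ) => (v : Matrix (Fin N) (Fin N) ℂ))
      (expUnitary_argSelfAdjoint hV)
    simp only [selfAdjoint.expUnitary_coe] at this ⊢
    rw [hVW, ← this, ← Matrix.exp_transpose, Matrix.transpose_smul]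
  rw [← hexp, argSelfAdjoint_expUnitary hlt']

/-- The spectrum is finite, so some phase rotates it away from `-1`, which puts the matrix in the
domain of the principal logarithm. -/
theorem exists_circle_norm_smul_sub_one_lt_two (V : Matrix (Fin N) (Fin N) ℂ)
    (hV : V ∈ unitary (Matrix (Fin N) (Fin N) ℂ)) :
    ∃ a : ℝ, cexp (I * a) • V ∈ unitary (Matrix (Fin N) (Fin N) ℂ) ∧ ‖cexp (I * a) • V - 1‖ < 2 := by
  have hu : ∀ a : ℝ, cexp (I * a) • V ∈ unitary (Matrix (Fin N) (Fin N) ℂ) := by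
    intro a
    have hc : star (cexp (I * a)) * cexp (I * a) = 1 := by
      rw [Complex.star_def, ← Complex.exp_conj, ← Complex.exp_add]; simp
    rw [Unitary.mem_iff] at hV ⊢
    constructor
    · rw [star_smul, smul_mul_smul_comm, hV.1, hc, one_smul]
    · rw [star_smul, smul_mul_smul_comm, hV.2, mul_comm, hc, one_smul]
  have hfin : (spectrum ℂ V).Finite := Matrix.finite_spectrum V
  -- Any infinite set of phases on which `a ↦ e^{-ia}` is injective would do; `[0, 1)` is shorter
  -- than `2π`.
  obtain ⟨a, ha, ha'⟩ : ∃ a ∈ Ico (0 : ℝ) 1, -cexp (-(I * a)) ∉ spectrum ℂ V := by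
    by_contra! h
    refine (Set.Ico_infinite (zero_lt_one' ℝ)) (Set.Finite.of_finite_image
      (hfin.subset (Set.image_subset_iff.2 h)) ?_)
    intro a ha b hb hab
    simp only [neg_inj] at hab
    rw [Complex.exp_eq_exp_iff_exists_int] at hab
    obtain ⟨n, hn⟩ := hab
    have hn' : -a = -b + n * (2 * Real.pi) := by
      have := congrArg Complex.im hn
      simpa using this
    have hn0 : n = 0 := by
      have h1 : |(n : ℝ)| * (2 * Real.pi) < 1 * (2 * Real.pi) := by
        rw [← abs_of_pos Real.two_pi_pos, ← abs_mul]
        rw [abs_of_pos Real.two_pi_pos]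
        rw [show (n : ℝ) * (2 * Real.pi) = b - a by linarith, abs_lt]
        constructor <;> linarith [ha.1, ha.2, hb.1, hb.2, Real.pi_gt_three]
      have h2 : |(n : ℝ)| < 1 := lt_of_mul_lt_mul_right h1 Real.two_pi_pos.le
      exact Int.abs_lt_one_iff.mp (by exact_mod_cast h2)
    subst hn0
    simp at hn'
    exact hn'
  refine ⟨a, hu a, (Unitary.norm_sub_one_lt_two_iff (hu a)).2 fun h => ha' ?_⟩
  rw [spectrum.mem_iff] at h ⊢
  intro h'
  apply h
  have : algebraMap ℂ (Matrix (Fin N) (Fin N) ℂ) (-1) - cexp (I * a) • V =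
      cexp (I * a) • (algebraMap ℂ (Matrix (Fin N) (Fin N) ℂ) (-cexp (-(I * a))) - V) := by
    rw [smul_sub, Algebra.algebraMap_eq_smul_one, Algebra.algebraMap_eq_smul_one, smul_smul,
      mul_neg, ← Complex.exp_add]
    simp
  rw [this]
  exact h'.smul (Units.mk0 _ (Complex.exp_ne_zero (I * a)))

/-- The principal logarithm of the rotated matrix, minus the scalar phase. It comes from functional
calculus, so it commutes with everything commuting with `V`; uniqueness of the principal logarithm
carries symmetry over. -/
theorem exists_logarithm {V : Matrix (Fin N) (Fin N) ℂ}
    (hV : V ∈ unitary (Matrix (Fin N) (Fin N) ℂ)) :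
    ∃ H : selfAdjoint (Matrix (Fin N) (Fin N) ℂ),
      (selfAdjoint.expUnitary H : Matrix (Fin N) (Fin N) ℂ) = V ∧
      (∀ D, Commute D V → Commute D (H : Matrix (Fin N) (Fin N) ℂ)) ∧
      (Vᵀ = V → (H : Matrix (Fin N) (Fin N) ℂ)ᵀ = H) := by
  obtain ⟨a, hu, hlt⟩ := exists_circle_norm_smul_sub_one_lt_two V hV
  set W : unitary (Matrix (Fin N) (Fin N) ℂ) := ⟨_, hu⟩ with hW
  set A := Unitary.argSelfAdjoint W with hA
  have hexp := congrArg (fun v : unitary (Matrix (Fin N) (Fin N) ℂ) => (v : Matrix (Fin N) (Fin N) ℂ))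
      (expUnitary_argSelfAdjoint (u := W) hlt)
  simp only [selfAdjoint.expUnitary_coe] at hexp
  have ha1 : IsSelfAdjoint ((a : ℂ) • (1 : Matrix (Fin N) (Fin N) ℂ)) := by
    rw [isSelfAdjoint_iff, star_smul, star_one]; simp
  refine ⟨A - ⟨(a : ℂ) • 1, ha1⟩, ?_, ?_, ?_⟩
  · rw [selfAdjoint.expUnitary_coe, AddSubgroupClass.coe_sub, smul_sub, sub_eq_add_neg,
      Matrix.exp_add_of_commute, hexp]
    · have : (-(I • (a : ℂ) • (1 : Matrix (Fin N) (Fin N) ℂ))) =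
          algebraMap ℂ (Matrix (Fin N) (Fin N) ℂ) (-(I * a)) := by
        rw [Algebra.algebraMap_eq_smul_one, smul_smul, neg_smul]
      rw [this, ← NormedSpace.algebraMap_exp_comm, ← Complex.exp_eq_exp_ℂ,
        Algebra.algebraMap_eq_smul_one, hW]
      simp only [mul_smul_comm, mul_one, smul_smul, ← Complex.exp_add]
      simp
    · refine Commute.neg_right ?_
      rw [smul_smul]
      exact (Commute.one_right _).smul_right _
  · intro D hD
    rw [AddSubgroupClass.coe_sub]
    refine Commute.sub_right ?_ ((Commute.one_right _).smul_right _)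
    have h1 : Commute D (W : Matrix (Fin N) (Fin N) ℂ) := hD.smul_right _
    have h2 : Commute D (star (W : Matrix (Fin N) (Fin N) ℂ)) := by
      have hWm := Unitary.mem_iff.1 W.2
      have : D * W = W * D := h1
      show D * star (W : Matrix (Fin N) (Fin N) ℂ) = star (W : Matrix (Fin N) (Fin N) ℂ) * D
      calc D * star (W : Matrix (Fin N) (Fin N) ℂ)
          = star (W : Matrix (Fin N) (Fin N) ℂ) * (W * D) * star (W : Matrix (Fin N) (Fin N) ℂ) := by
            rw [← mul_assoc, hWm.1, one_mul]
        _ = star (W : Matrix (Fin N) (Fin N) ℂ) * D := by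
            rw [← this, mul_assoc, mul_assoc, hWm.2, mul_one]
    rw [hA, Unitary.argSelfAdjoint_coe]
    exact (Commute.cfc h1.symm h2.symm _).symm
  · intro hT
    rw [AddSubgroupClass.coe_sub, Matrix.transpose_sub, hA,
      ← argSelfAdjoint_transpose W W hlt (by simp [hW, hT])]
    simp

end Logarithm

/-! ### Spectral data and the map to unitary matrices. -/

section Diagonalization

open scoped Matrix.Norms.L2Operator
open Complex NormedSpace

variable {N : ℕ}

/-- The matrix `U diag(d) U*`. -/
def conjDiagonal (U : unitary (Matrix (Fin N) (Fin N) ℂ)) (d : Fin N → ℂ) :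
    Matrix (Fin N) (Fin N) ℂ :=
  (U : Matrix (Fin N) (Fin N) ℂ) * diagonal d * star (U : Matrix (Fin N) (Fin N) ℂ)

/-- The Hermitian matrix `U diag(l) U*`. -/
def spectralHermitian (x : unitary (Matrix (Fin N) (Fin N) ℂ) × (Fin N → ℝ)) :
    Matrix (Fin N) (Fin N) ℂ :=
  conjDiagonal x.1 fun j => (x.2 j : ℂ)

/-- The unitary matrix `U diag(e^{il}) U*`. -/
noncomputable def spectralUnitary (x : unitary (Matrix (Fin N) (Fin N) ℂ) × (Fin N → ℝ)) :
    Matrix (Fin N) (Fin N) ℂ :=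
  conjDiagonal x.1 fun j => cexp (I * x.2 j)

theorem exp_smul_conjDiagonal (U : unitary (Matrix (Fin N) (Fin N) ℂ)) (c : ℂ) (d : Fin N → ℂ) :
    exp (c • conjDiagonal U d) = conjDiagonal U fun j => cexp (c * d j) := by
  have h := Matrix.exp_units_conj (Unitary.toUnits U) (diagonal (c • d))
  rw [Matrix.exp_diagonal] at h
  have h1 : c • conjDiagonal U d = (Unitary.toUnits U : Matrix (Fin N) (Fin N) ℂ) *
      diagonal (c • d) * ((Unitary.toUnits U)⁻¹ : (Matrix (Fin N) (Fin N) ℂ)ˣ) := by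
    rw [conjDiagonal, diagonal_smul, mul_smul_comm, smul_mul_assoc]
    rfl
  rw [h1, h, conjDiagonal]
  congr 3
  funext j
  rw [Pi.coe_exp, Complex.exp_eq_exp_ℂ]
  rfl

theorem exp_I_smul_spectralHermitian (x : unitary (Matrix (Fin N) (Fin N) ℂ) × (Fin N → ℝ)) :
    exp (I • spectralHermitian x) = spectralUnitary x :=
  exp_smul_conjDiagonal _ _ _

theorem isHermitian_spectralHermitian (x : unitary (Matrix (Fin N) (Fin N) ℂ) × (Fin N → ℝ)) :
    (spectralHermitian x).IsHermitian := by
  have h : (diagonal fun j => (x.2 j : ℂ)).IsHermitian :=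
    Matrix.isHermitian_diagonal_of_self_adjoint _ (by ext j; simp)
  exact Matrix.isHermitian_mul_mul_conjTranspose _ h

theorem continuous_spectralHermitian :
    Continuous (spectralHermitian : unitary (Matrix (Fin N) (Fin N) ℂ) × (Fin N → ℝ) → _) := by
  unfold spectralHermitian conjDiagonal
  fun_prop

theorem continuous_spectralUnitary :
    Continuous (spectralUnitary : unitary (Matrix (Fin N) (Fin N) ℂ) × (Fin N → ℝ) → _) := by
  unfold spectralUnitary conjDiagonal
  fun_prop

theorem spectralHermitian_transpose {x : unitary (Matrix (Fin N) (Fin N) ℂ) × (Fin N → ℝ)}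
    (hx : conjMatrix (x.1 : Matrix (Fin N) (Fin N) ℂ) = x.1) :
    (spectralHermitian x)ᵀ = spectralHermitian x := by
  have h1 : (x.1 : Matrix (Fin N) (Fin N) ℂ)ᵀ = star (x.1 : Matrix (Fin N) (Fin N) ℂ) := by
    conv_lhs => rw [← hx, conjMatrix_eq_transpose_conjTranspose]
    rfl
  have h2 : (star (x.1 : Matrix (Fin N) (Fin N) ℂ))ᵀ = x.1 := by rw [← h1, transpose_transpose]
  rw [spectralHermitian, conjDiagonal, transpose_mul, transpose_mul, diagonal_transpose, h1, h2,
    mul_assoc]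

theorem exists_spectralUnitary_eq {V : Matrix (Fin N) (Fin N) ℂ}
    (hV : V ∈ unitary (Matrix (Fin N) (Fin N) ℂ)) : ∃ x, spectralUnitary x = V := by
  obtain ⟨H, hH, -, -⟩ := exists_logarithm hV
  have hHerm : (H : Matrix (Fin N) (Fin N) ℂ).IsHermitian := H.2
  refine ⟨(hHerm.eigenvectorUnitary, hHerm.eigenvalues), ?_⟩
  rw [← exp_I_smul_spectralHermitian, ← hH, selfAdjoint.expUnitary_coe]
  congr 2
  exact hHerm.spectral_theorem.symm

/-- The logarithm of a symmetric unitary is both symmetric and Hermitian, hence real, and the real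
spectral theorem diagonalizes it. -/
theorem exists_real_spectralUnitary_eq {V : Matrix (Fin N) (Fin N) ℂ}
    (hV : V ∈ unitary (Matrix (Fin N) (Fin N) ℂ)) (hVT : Vᵀ = V) :
    ∃ x, spectralUnitary x = V ∧ conjMatrix (x.1 : Matrix (Fin N) (Fin N) ℂ) = x.1 := by
  obtain ⟨H, hH, -, hT⟩ := exists_logarithm hV
  have hHerm : (H : Matrix (Fin N) (Fin N) ℂ).IsHermitian := H.2
  set A : Matrix (Fin N) (Fin N) ℝ := (H : Matrix (Fin N) (Fin N) ℂ).map re with hA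
  have hAH : A.map ofReal = (H : Matrix (Fin N) (Fin N) ℂ) := by
    ext i j
    have h1 := congrFun (congrFun (hT hVT) i) j
    have h2 := congrFun (congrFun hHerm i) j
    rw [transpose_apply] at h1
    rw [conjTranspose_apply, h1] at h2
    exact Complex.conj_eq_iff_re.1 h2
  have hAherm : A.IsHermitian := by
    ext i j
    have h1 := congrFun (congrFun (hT hVT) i) j
    rw [transpose_apply] at h1
    simp [hA, h1]
  set Q : Matrix (Fin N) (Fin N) ℝ := hAherm.eigenvectorUnitary.1 with hQ
  have hmap : ∀ M M' : Matrix (Fin N) (Fin N) ℝ,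
      (M * M').map ofReal = M.map ofReal * M'.map ofReal := fun M M' =>
    Matrix.map_mul (f := Complex.ofRealHom)
  have hstar : star (Q.map ofReal) = (star Q).map ofReal := by
    ext i j; simp [Matrix.star_apply]
  have hone : (1 : Matrix (Fin N) (Fin N) ℝ).map ofReal = (1 : Matrix (Fin N) (Fin N) ℂ) :=
    Matrix.map_one _ (by simp) (by simp)
  have hQu : Q.map ofReal ∈ unitary (Matrix (Fin N) (Fin N) ℂ) := by
    have := Unitary.mem_iff.1 hAherm.eigenvectorUnitary.2
    rw [Unitary.mem_iff, hstar, ← hmap, ← hmap, this.1, this.2, hone]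
    exact ⟨rfl, rfl⟩
  refine ⟨(⟨_, hQu⟩, hAherm.eigenvalues), ?_, ?_⟩
  · rw [← exp_I_smul_spectralHermitian, ← hH, selfAdjoint.expUnitary_coe]
    congr 2
    have h := congrArg (fun M : Matrix (Fin N) (Fin N) ℝ => M.map ofReal) hAherm.spectral_theorem
    simp only [Unitary.conjStarAlgAut_apply, hmap, hAH] at h
    rw [h, spectralHermitian, conjDiagonal, hstar]
    congr 2
    rw [Matrix.diagonal_map (by simp)]
    rfl
  · ext i j; simp [conjMatrix]

/-- The two diagonals are the same multiset of roots of one characteristic polynomial. -/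
theorem exists_perm_of_conjDiagonal_eq {U U' : unitary (Matrix (Fin N) (Fin N) ℂ)}
    {d d' : Fin N → ℂ} (h : conjDiagonal U d = conjDiagonal U' d') :
    ∃ σ : Equiv.Perm (Fin N), ∀ j, d' (σ j) = d j := by
  have hroots : ∀ (U : unitary (Matrix (Fin N) (Fin N) ℂ)) (d : Fin N → ℂ),
      (conjDiagonal U d).charpoly.roots = Finset.univ.val.map d := by
    intro U d
    rw [conjDiagonal, Matrix.charpoly_mul_comm, ← mul_assoc, (Unitary.mem_iff.1 U.2).1, one_mul,
      Matrix.charpoly_diagonal]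
    have := Polynomial.roots_multiset_prod_X_sub_C (Finset.univ.val.map d)
    rwa [Multiset.map_map] at this
  have hm : Finset.univ.val.map d = Finset.univ.val.map d' := by
    rw [← hroots U d, ← hroots U' d', h]
  have hcard : ∀ c, Nonempty ({j // d j = c} ≃ {j // d' j = c}) := by
    intro c
    have := congrArg (Multiset.count c) hm
    rw [Multiset.count_map, Multiset.count_map] at this
    refine Fintype.card_eq.1 ?_
    rw [Fintype.card_subtype, Fintype.card_subtype]
    simpa [Finset.card, Finset.filter, eq_comm] using this
  exact ⟨Equiv.ofFiberEquiv fun c => (hcard c).some, fun j => Equiv.ofFiberEquiv_map _ j⟩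

/-- Permuting the eigenvectors together with the eigenvalues, then shifting the eigenvalues by
integer multiples of `2π`. -/
noncomputable def permShift (σ : Equiv.Perm (Fin N)) (n : Fin N → ℤ) :
    (unitary (Matrix (Fin N) (Fin N) ℂ) × (Fin N → ℝ)) ≃ₜ
      (unitary (Matrix (Fin N) (Fin N) ℂ) × (Fin N → ℝ)) :=
  have hmem : ∀ (τ : Equiv.Perm (Fin N)) (U : unitary (Matrix (Fin N) (Fin N) ℂ)),
      (U : Matrix (Fin N) (Fin N) ℂ).submatrix id τ ∈ unitary (Matrix (Fin N) (Fin N) ℂ) := by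
    intro τ U
    refine Matrix.mem_unitaryGroup_iff.2 ?_
    rw [star_eq_conjTranspose, conjTranspose_submatrix, submatrix_mul_equiv,
      ← star_eq_conjTranspose, (Unitary.mem_iff.1 U.2).2, submatrix_id_id]
  { toFun := fun x => (⟨_, hmem σ x.1⟩, fun j => x.2 (σ j) + n j * (2 * Real.pi))
    invFun := fun x =>
      (⟨_, hmem σ.symm x.1⟩, fun j => x.2 (σ.symm j) - n (σ.symm j) * (2 * Real.pi))
    left_inv := fun x => by ext <;> simp
    right_inv := fun x => by ext <;> simp
    continuous_toFun := by
      refine Continuous.prodMk (Continuous.subtype_mk ?_ _) (by fun_prop)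
      exact (continuous_subtype_val.comp continuous_fst).matrix_submatrix _ _
    continuous_invFun := by
      refine Continuous.prodMk (Continuous.subtype_mk ?_ _) (by fun_prop)
      exact (continuous_subtype_val.comp continuous_fst).matrix_submatrix _ _ }

theorem permShift_fst (σ : Equiv.Perm (Fin N)) (n : Fin N → ℤ)
    (x : unitary (Matrix (Fin N) (Fin N) ℂ) × (Fin N → ℝ)) :
    ((permShift σ n x).1 : Matrix (Fin N) (Fin N) ℂ) =
      (x.1 : Matrix (Fin N) (Fin N) ℂ).submatrix id σ := rfl

theorem permShift_snd (σ : Equiv.Perm (Fin N)) (n : Fin N → ℤ)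
    (x : unitary (Matrix (Fin N) (Fin N) ℂ) × (Fin N → ℝ)) (j : Fin N) :
    (permShift σ n x).2 j = x.2 (σ j) + n j * (2 * Real.pi) := rfl

/-- The homeomorphisms of the space of spectral data that preserve the unitary matrix they
represent and the reality of the eigenvectors. -/
def spectralSymmetry (N : ℕ) : Subgroup ((unitary (Matrix (Fin N) (Fin N) ℂ) × (Fin N → ℝ)) ≃ₜ
      (unitary (Matrix (Fin N) (Fin N) ℂ) × (Fin N → ℝ))) where
  carrier := {g | ∀ x, spectralUnitary (g x) = spectralUnitary x ∧
    (conjMatrix ((g x).1 : Matrix (Fin N) (Fin N) ℂ) = (g x).1 ↔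
      conjMatrix (x.1 : Matrix (Fin N) (Fin N) ℂ) = x.1)}
  mul_mem' := fun {g g'} hg hg' x =>
    ⟨(hg (g' x)).1.trans (hg' x).1, (hg (g' x)).2.trans (hg' x).2⟩
  one_mem' := fun x => ⟨rfl, Iff.rfl⟩
  inv_mem' := fun {g} hg x => by
    have h := hg (g⁻¹ x)
    have hx : g (g⁻¹ x) = x := g.apply_symm_apply x
    rw [hx] at h
    exact ⟨h.1.symm, h.2.symm⟩

theorem permShift_mem (σ : Equiv.Perm (Fin N)) (n : Fin N → ℤ) :
    permShift σ n ∈ spectralSymmetry N := by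
  refine fun x => ⟨?_, ?_⟩
  · have hd : (fun j => cexp (I * (permShift σ n x).2 j)) =
        (fun j => cexp (I * x.2 j)) ∘ σ := by
      funext j
      rw [permShift_snd, Function.comp_apply, Complex.exp_eq_exp_iff_exists_int]
      exact ⟨n j, by push_cast; ring⟩
    rw [spectralUnitary, conjDiagonal, hd, permShift_fst, ← submatrix_diagonal_equiv,
      star_eq_conjTranspose, conjTranspose_submatrix, submatrix_mul_equiv, submatrix_mul_equiv,
      submatrix_id_id]
    rfl
  · rw [permShift_fst]
    constructor
    · intro h
      ext i j
      simpa [conjMatrix] using congrFun (congrFun h i) (σ.symm j)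
    · intro h
      ext i j
      simpa [conjMatrix] using congrFun (congrFun h i) (σ j)

/-- Once a permutation and shifts have aligned the eigenvalues, the two eigenbases differ by a
unitary commuting with `V`. Its logarithm also commutes with `V`, so the one-parameter group it
generates moves one basis to the other inside the fibre. -/
theorem exists_joinedIn_fiber (x y : unitary (Matrix (Fin N) (Fin N) ℂ) × (Fin N → ℝ))
    (hxy : spectralUnitary x = spectralUnitary y) :
    ∃ g ∈ spectralSymmetry N, JoinedIn (spectralUnitary ⁻¹' {spectralUnitary x}) x (g y) := by
  obtain ⟨σ, hσ⟩ := exists_perm_of_conjDiagonal_eq hxy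
  have hn : ∀ j, ∃ n : ℤ, x.2 j = y.2 (σ j) + n * (2 * Real.pi) := by
    intro j
    obtain ⟨n, hn⟩ := Complex.exp_eq_exp_iff_exists_int.1 (hσ j).symm
    refine ⟨n, ?_⟩
    have := congrArg Complex.im hn
    simpa using this
  choose n hn using hn
  refine ⟨permShift σ n, permShift_mem σ n, ?_⟩
  set z := permShift σ n y with hz
  have hz2 : z.2 = x.2 := by funext j; rw [hz, permShift_snd, hn]
  have hzf : spectralUnitary z = spectralUnitary x :=
    (permShift_mem σ n y).1.trans hxy.symm
  set V := spectralUnitary x with hV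
  set D : Matrix (Fin N) (Fin N) ℂ := diagonal fun j => cexp (I * x.2 j) with hD
  have hVx : V = x.1 * D * star (x.1 : Matrix (Fin N) (Fin N) ℂ) := rfl
  have hVz : V = z.1 * D * star (z.1 : Matrix (Fin N) (Fin N) ℂ) := by
    rw [← hzf, spectralUnitary, conjDiagonal, hz2]
  obtain ⟨H, hH, hcomm, -⟩ := exists_logarithm (z.1 * star x.1).2
  have hVH : Commute V (H : Matrix (Fin N) (Fin N) ℂ) := by
    refine hcomm V ?_
    have hx1 := (Unitary.mem_iff.1 x.1.2).1
    have hz1 := (Unitary.mem_iff.1 z.1.2).1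
    have e1 : V * z.1 = z.1 * D := by rw [hVz, mul_assoc, hz1, mul_one]
    have e2 : star (x.1 : Matrix (Fin N) (Fin N) ℂ) * V = D * star (x.1 : Matrix (Fin N) (Fin N) ℂ) := by
      rw [hVx, ← mul_assoc, ← mul_assoc, hx1, one_mul]
    show V * (z.1 * star (x.1 : Matrix (Fin N) (Fin N) ℂ)) =
      z.1 * star (x.1 : Matrix (Fin N) (Fin N) ℂ) * V
    rw [← mul_assoc, e1, mul_assoc, mul_assoc, e2]
  have hHz : selfAdjoint.expUnitary H = z.1 * star x.1 := Subtype.ext hH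
  refine ⟨⟨⟨fun t => (selfAdjoint.expUnitary ((t : ℝ) • H) * x.1, x.2), by fun_prop⟩, ?_, ?_⟩, ?_⟩
  · simp
  · refine Prod.ext ?_ hz2.symm
    simp [hHz, mul_assoc]
  · intro t
    set E := selfAdjoint.expUnitary ((t : ℝ) • H) with hE
    have hcE : Commute V (E : Matrix (Fin N) (Fin N) ℂ) := by
      rw [hE, selfAdjoint.expUnitary_coe]
      refine Commute.exp_right ?_
      exact ((hVH.smul_right (t : ℝ))).smul_right I
    show conjDiagonal (E * x.1) _ = V
    rw [conjDiagonal, Submonoid.coe_mul, star_mul]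
    calc (E : Matrix (Fin N) (Fin N) ℂ) * x.1 * D * (star (x.1 : Matrix (Fin N) (Fin N) ℂ) * star (E : Matrix (Fin N) (Fin N) ℂ))
        = E * V * star (E : Matrix (Fin N) (Fin N) ℂ) := by rw [hVx]; simp only [mul_assoc]
      _ = V := by rw [← hcE.eq, mul_assoc, (Unitary.mem_iff.1 E.2).2, mul_one]

theorem exists_mem_fundamental_domain (x : unitary (Matrix (Fin N) (Fin N) ℂ) × (Fin N → ℝ)) :
    ∃ g ∈ spectralSymmetry N, g x ∈ univ ×ˢ Icc (0 : Fin N → ℝ) (fun _ => 2 * Real.pi) := by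
  refine ⟨permShift 1 fun j => -toIcoDiv Real.two_pi_pos 0 (x.2 j), permShift_mem _ _,
    mem_univ _, ?_⟩
  have h : ∀ j, (permShift 1 (fun j => -toIcoDiv Real.two_pi_pos 0 (x.2 j)) x).2 j ∈
      Ico 0 (2 * Real.pi) := by
    intro j
    have := toIcoMod_mem_Ico Real.two_pi_pos 0 (x.2 j)
    rw [permShift_snd]
    rw [toIcoMod, zero_add] at this
    simpa [sub_eq_add_neg] using this
  exact ⟨fun j => (h j).1, fun j => (h j).2.le⟩

theorem isCompact_unitary_matrix :
    IsCompact (univ : Set (unitary (Matrix (Fin N) (Fin N) ℂ))) := by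
  rw [Subtype.isCompact_iff, image_univ, Subtype.range_coe]
  have : ProperSpace (Matrix (Fin N) (Fin N) ℂ) := FiniteDimensional.proper ℂ _
  refine Metric.isCompact_of_isClosed_isBounded isClosed_unitary ?_
  refine (Metric.isBounded_closedBall (x := (0 : Matrix (Fin N) (Fin N) ℂ)) (r := 1)).subset ?_
  intro U hU
  rw [mem_closedBall_zero_iff]
  rcases subsingleton_or_nontrivial (Matrix (Fin N) (Fin N) ℂ) with _ | _
  · rw [Subsingleton.elim U 0]; simp
  · exact (CStarRing.norm_of_mem_unitary hU).le

/-- The lift starts and ends at real eigenvectors; the final correction by `spectralSymmetry`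
preserves reality, so the Hermitian path is symmetric at both ends. -/
theorem exists_spectral_path {β : ℝ → Matrix (Fin N) (Fin N) ℂ} (hβc : Continuous β)
    (hβu : ∀ t, β t ∈ unitary (Matrix (Fin N) (Fin N) ℂ)) {b : ℝ} (hb : 0 < b)
    (h0 : (β 0)ᵀ = β 0) (h1 : (β b)ᵀ = β b) {ε : ℝ} (hε : 0 < ε) :
    ∃ h : ℝ → Matrix (Fin N) (Fin N) ℂ, Continuous h ∧ (∀ t, (h t).IsHermitian) ∧
      (h 0)ᵀ = h 0 ∧ (h b)ᵀ = h b ∧ ∀ t ∈ Icc 0 b, ‖exp (I • h t) - β t‖ < ε := by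
  obtain ⟨x, hx, hxr⟩ := exists_real_spectralUnitary_eq (hβu 0) h0
  obtain ⟨y, hy, hyr⟩ := exists_real_spectralUnitary_eq (hβu b) h1
  obtain ⟨g, hg, γ, hγ, hγ0, hγb, hd⟩ := exists_approx_lift continuous_spectralUnitary
    (spectralSymmetry N) (fun g hg x => (hg x).1) exists_joinedIn_fiber
    (isCompact_unitary_matrix.prod isCompact_Icc) exists_mem_fundamental_domain hβc
    (fun t => exists_spectralUnitary_eq (hβu t)) hε hb hx hy
  refine ⟨fun t => spectralHermitian (γ t), continuous_spectralHermitian.comp hγ,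
    fun t => isHermitian_spectralHermitian _, ?_, ?_, fun t ht => ?_⟩
  · simp only [hγ0]
    exact spectralHermitian_transpose hxr
  · simp only [hγb]
    exact spectralHermitian_transpose ((hg y).2.2 hyr)
  · rw [exp_I_smul_spectralHermitian, ← dist_eq_norm]
    exact hd t ht

end Diagonalization

/-! ### Good families: approximation, logarithm and matching. -/

section GoodFamilies

open scoped Matrix.Norms.L2Operator
open Complex NormedSpace

variable {N : ℕ}

theorem l2_opNorm_transpose_le (M : Matrix (Fin N) (Fin N) ℂ) : ‖Mᵀ‖ ≤ ‖M‖ := by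
  have h := l2_opNorm_conjMatrix_le Mᴴ
  rwa [conjMatrix_eq_transpose_conjTranspose, conjTranspose_conjTranspose,
    Matrix.l2_opNorm_conjTranspose] at h

theorem IsMatchingFamily.transpose_eq {β : ℝ → Matrix (Fin N) (Fin N) ℂ} (hβ : IsMatchingFamily β)
    (k : ℝ) : (β k)ᵀ = β (-k) :=
  (hasCSPrime_iff_transpose β hβ.unitary).1 hβ.csPrime k

theorem IsGoodFamily.transpose_eq {h : ℝ → Matrix (Fin N) (Fin N) ℂ} (hh : IsGoodFamily h)
    (k : ℝ) : (h k)ᵀ = h (-k) := by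
  rw [← (hh.selfAdjoint k).conjMatrix_eq, hh.cs k]

theorem exists_periodic_reflection {h₀ : ℝ → Matrix (Fin N) (Fin N) ℂ} (hc : Continuous h₀)
    (hH : ∀ t, (h₀ t).IsHermitian) (h0 : (h₀ 0)ᵀ = h₀ 0) (h1 : (h₀ (1 / 2))ᵀ = h₀ (1 / 2)) :
    ∃ h, IsGoodFamily h ∧ ∀ t ∈ Icc (0 : ℝ) (1 / 2), h t = h₀ t := by
  set g : ℝ → Matrix (Fin N) (Fin N) ℂ := fun t => if 0 ≤ t then h₀ t else (h₀ (-t))ᵀ with hg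
  have hg_pos : ∀ t, 0 ≤ t → g t = h₀ t := fun t ht => if_pos ht
  have hg_neg : ∀ t, 0 ≤ t → g (-t) = (h₀ t)ᵀ := by
    intro t ht
    rcases ht.eq_or_lt with rfl | ht
    · rw [neg_zero, hg_pos 0 le_rfl, h0]
    · rw [hg]
      simp only [if_neg (not_le.2 (neg_neg_of_pos ht)), neg_neg]
  have hgc : Continuous g := by
    refine Continuous.if_le hc (hc.comp continuous_neg).matrix_transpose continuous_const
      continuous_id ?_
    rintro t rfl
    simp [h0]
  have hgT : ∀ t, (g t)ᵀ = g (-t) := by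
    intro t
    rcases le_total 0 t with ht | ht
    · rw [hg_pos t ht, hg_neg t ht]
    · obtain ⟨s, rfl⟩ : ∃ s, t = -s := ⟨-t, (neg_neg t).symm⟩
      have hs : 0 ≤ s := neg_nonpos.1 ht
      rw [neg_neg, hg_neg s hs, hg_pos s hs, transpose_transpose]
  have hgH : ∀ t, (g t).IsHermitian := by
    intro t
    rw [hg]
    dsimp only
    split_ifs
    · exact hH t
    · exact (hH (-t)).transpose
  -- Symmetry at `1/2` is exactly the gluing condition for the periodic extension, as symmetry at
  -- `0` was for the reflection.
  have hgend : g (-(1 / 2)) = g (-(1 / 2) + 1) := by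
    rw [hg_neg _ (by norm_num), hg_pos _ (by norm_num), h1]
    norm_num
  set h : ℝ → Matrix (Fin N) (Fin N) ℂ :=
    fun k => AddCircle.liftIco (1 : ℝ) (-(1 / 2)) g (k : AddCircle (1 : ℝ)) with hh
  have hhg : ∀ t ∈ Icc (-(1 / 2) : ℝ) (1 / 2), h t = g t := by
    intro t ht
    rcases ht.2.eq_or_lt with rfl | ht'
    · have e : ((1 / 2 : ℝ) : AddCircle (1 : ℝ)) = ((-(1 / 2) : ℝ) : AddCircle (1 : ℝ)) := by
        rw [← AddCircle.coe_add_period 1 (-(1 / 2) : ℝ)]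
        norm_num
      rw [hh]
      dsimp only
      rw [e, AddCircle.liftIco_coe_apply (by norm_num), hgend]
      norm_num
    · exact AddCircle.liftIco_coe_apply ⟨ht.1, by linarith⟩
  have hper : Function.Periodic h 1 := fun k => by
    rw [hh]
    dsimp only
    rw [AddCircle.coe_add_period]
  have hred : ∀ k, ∃ t ∈ Icc (-(1 / 2) : ℝ) (1 / 2), h k = g t ∧ h (-k) = g (-t) := by
    intro k
    obtain ⟨n, hn, -⟩ := existsUnique_sub_zsmul_mem_Ico one_pos k (-(1 / 2) : ℝ)
    have hn' : k - n • (1 : ℝ) ∈ Icc (-(1 / 2) : ℝ) (1 / 2) := ⟨hn.1, by linarith [hn.2]⟩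
    refine ⟨_, hn', ?_, ?_⟩
    · rw [← hhg _ hn', hper.sub_zsmul_eq]
    · rw [← hhg _ ⟨by linarith [hn'.2], by linarith [hn'.1]⟩, neg_sub, ← neg_add_eq_sub,
        hper.zsmul n (-k)]
  refine ⟨h, ⟨fun k => ?_, ?_, hper, fun k => ?_⟩, fun t ht => ?_⟩
  · obtain ⟨t, -, ht, -⟩ := hred k
    rw [ht]
    exact hgH t
  · exact (AddCircle.liftIco_continuous hgend hgc.continuousOn).comp (AddCircle.continuous_mk' 1)
  · obtain ⟨t, -, ht, ht'⟩ := hred k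
    rw [ht, ht', (hgH t).conjMatrix_eq, hgT]
  · rw [hhg t ⟨by linarith [ht.1], ht.2⟩, hg_pos t ht.1]

/-- An estimate on `[0, 1/2]` suffices: transposition carries it to negative `k`, and periodicity to
all `k`. -/
theorem exists_isGoodFamily_near {β : ℝ → Matrix (Fin N) (Fin N) ℂ} (hβ : IsMatchingFamily β)
    {ε : ℝ} (hε : 0 < ε) :
    ∃ h, IsGoodFamily h ∧ ∀ k, ‖exp (I • h k) - β k‖ < ε := by
  have hhalf : (β (1 / 2))ᵀ = β (1 / 2) := by
    rw [hβ.transpose_eq, ← hβ.periodic]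
    norm_num
  obtain ⟨h₀, hc, hH, h0, h1, hd⟩ := exists_spectral_path hβ.continuous hβ.unitary
    (b := 1 / 2) (by norm_num) (by rw [hβ.transpose_eq, neg_zero]) hhalf hε
  obtain ⟨h, hh, hhh⟩ := exists_periodic_reflection hc hH h0 h1
  refine ⟨h, hh, ?_⟩
  have hpos : ∀ t ∈ Icc (0 : ℝ) (1 / 2), ‖exp (I • h t) - β t‖ < ε := fun t ht => by
    rw [hhh t ht]; exact hd t ht
  have hneg : ∀ t ∈ Icc (0 : ℝ) (1 / 2), ‖exp (I • h (-t)) - β (-t)‖ < ε := fun t ht => by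
    rw [← hh.transpose_eq, ← hβ.transpose_eq, ← transpose_smul, Matrix.exp_transpose,
      ← transpose_sub]
    exact (l2_opNorm_transpose_le _).trans_lt (hpos t ht)
  intro k
  obtain ⟨n, hn, -⟩ := existsUnique_sub_zsmul_mem_Ico one_pos k (-(1 / 2) : ℝ)
  rw [← hh.periodic.sub_zsmul_eq n, ← hβ.periodic.sub_zsmul_eq n]
  rcases le_total 0 (k - n • (1 : ℝ)) with h | h
  · exact hpos _ ⟨h, by linarith [hn.2]⟩
  · have := hneg (-(k - n • (1 : ℝ))) ⟨by linarith, by linarith [hn.1]⟩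
    rwa [neg_neg] at this

theorem exp_neg_I_mul_smul_mem_unitary {H : Matrix (Fin N) (Fin N) ℂ} (hH : H.IsHermitian)
    (x : ℝ) : exp ((-(I * (x : ℂ))) • H) ∈ unitary (Matrix (Fin N) (Fin N) ℂ) := by
  have hx : IsSelfAdjoint ((((-x : ℝ)) : ℂ) • H) := by
    have : star H = H := hH
    rw [isSelfAdjoint_iff, star_smul, this]
    simp
  have := (selfAdjoint.expUnitary ⟨_, hx⟩).2
  rw [selfAdjoint.expUnitary_coe, smul_smul] at this
  have h : -(I * (x : ℂ)) = I * ((-x : ℝ) : ℂ) := by push_cast; ring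
  rwa [h]

theorem exp_neg_half_I_smul_mem_unitary {H : Matrix (Fin N) (Fin N) ℂ} (hH : H.IsHermitian) :
    exp ((-(I / 2)) • H) ∈ unitary (Matrix (Fin N) (Fin N) ℂ) := by
  have h : -(I / 2) = -(I * ((1 / 2 : ℝ) : ℂ)) := by push_cast; ring
  rw [h]
  exact exp_neg_I_mul_smul_mem_unitary hH (1 / 2)

theorem norm_le_one_of_mem_unitary {U : Matrix (Fin N) (Fin N) ℂ}
    (hU : U ∈ unitary (Matrix (Fin N) (Fin N) ℂ)) : ‖U‖ ≤ 1 := by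
  rcases subsingleton_or_nontrivial (Matrix (Fin N) (Fin N) ℂ) with _ | _
  · rw [Subsingleton.elim U 0]; simp
  · exact (CStarRing.norm_of_mem_unitary hU).le

theorem exp_smul_mul_exp_smul (a b : ℂ) (H : Matrix (Fin N) (Fin N) ℂ) :
    exp (a • H) * exp (b • H) = exp ((a + b) • H) := by
  rw [add_smul, Matrix.exp_add_of_commute]
  exact ((Commute.refl H).smul_left a).smul_right b

theorem continuous_exp_matrix :
    Continuous (exp : Matrix (Fin N) (Fin N) ℂ → Matrix (Fin N) (Fin N) ℂ) := by
  let +nondep : NormedAlgebra ℚ (Matrix (Fin N) (Fin N) ℂ) := .restrictScalars ℚ ℂ _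
  exact NormedSpace.exp_continuous

theorem rotatedFamily_isMatching {h β : ℝ → Matrix (Fin N) (Fin N) ℂ} (hh : IsGoodFamily h)
    (hβ : IsMatchingFamily β) : IsMatchingFamily (rotatedFamily h β) := by
  have hu : ∀ k, rotatedFamily h β k ∈ Matrix.unitaryGroup (Fin N) ℂ := fun k =>
    mul_mem (mul_mem (exp_neg_half_I_smul_mem_unitary (hh.selfAdjoint k)) (hβ.unitary k))
      (exp_neg_half_I_smul_mem_unitary (hh.selfAdjoint k))
  have hE : Continuous fun k => exp ((-(I / 2)) • h k) :=
    continuous_exp_matrix.comp (by have := hh.continuous; fun_prop)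
  refine ⟨hu, (hE.mul hβ.continuous).mul hE, fun k => ?_,
    (hasCSPrime_iff_transpose _ hu).2 fun k => ?_⟩
  · simp only [rotatedFamily, hh.periodic k, hβ.periodic k]
  · simp only [rotatedFamily, transpose_mul, ← Matrix.exp_transpose, transpose_smul,
      hh.transpose_eq, hβ.transpose_eq, mul_assoc]

theorem norm_rotatedFamily_sub_one_le {h β : ℝ → Matrix (Fin N) (Fin N) ℂ} (hh : IsGoodFamily h)
    (k : ℝ) : ‖rotatedFamily h β k - 1‖ ≤ ‖exp (I • h k) - β k‖ := by
  set E := exp ((-(I / 2)) • h k) with hE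
  have h1 : E * exp (I • h k) * E = 1 := by
    rw [hE, exp_smul_mul_exp_smul, exp_smul_mul_exp_smul]
    ring_nf
    simp
  have h2 : rotatedFamily h β k - 1 = E * (β k - exp (I • h k)) * E := by
    rw [mul_sub, sub_mul, h1]
    rfl
  have hE1 : ‖E‖ ≤ 1 := norm_le_one_of_mem_unitary (exp_neg_half_I_smul_mem_unitary (hh.selfAdjoint k))
  rw [h2, norm_sub_rev (exp (I • h k))]
  calc ‖E * (β k - exp (I • h k)) * E‖ ≤ ‖E‖ * ‖β k - exp (I • h k)‖ * ‖E‖ := norm_mul₃_le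
    _ ≤ 1 * ‖β k - exp (I • h k)‖ * 1 := by gcongr
    _ = _ := by ring

theorem exists_isGoodFamily_matrixOpNorm_le {β : ℝ → Matrix (Fin N) (Fin N) ℂ}
    (hβ : IsMatchingFamily β) {ε : ℝ} (hε : 0 < ε) :
    ∃ h, IsGoodFamily h ∧ ∀ k, matrixOpNorm (rotatedFamily h β k - 1) ≤ ε := by
  obtain ⟨h, hh, hnear⟩ := exists_isGoodFamily_near hβ hε
  exact ⟨h, hh, fun k => (norm_rotatedFamily_sub_one_le hh k).trans (hnear k).le⟩

/-- The principal logarithm is continuous at distance less than `2` from the identity; its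
compatibility with transposition turns `CS'` for `β` into `CS` for the logarithm. -/
theorem exists_isGoodLogarithm {β : ℝ → Matrix (Fin N) (Fin N) ℂ} (hβ : IsMatchingFamily β)
    (hlt : ∀ k, matrixOpNorm (β k - 1) < 2) : ∃ h, IsGoodLogarithm h β := by
  set b : ℝ → unitary (Matrix (Fin N) (Fin N) ℂ) := fun k => ⟨β k, hβ.unitary k⟩ with hb
  have hbc : Continuous b := hβ.continuous.subtype_mk _
  have hself : ∀ k, (Unitary.argSelfAdjoint (b k) : Matrix (Fin N) (Fin N) ℂ).IsHermitian :=
    fun k => (Unitary.argSelfAdjoint (b k)).2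
  refine ⟨fun k => Unitary.argSelfAdjoint (b k), ⟨hself, ?_, fun k => ?_, fun k => ?_⟩,
    fun k => ?_⟩
  · refine continuous_subtype_val.comp
      (Unitary.continuousOn_argSelfAdjoint.comp_continuous hbc fun k => ?_)
    rw [Metric.mem_ball, Subtype.dist_eq, dist_eq_norm]
    exact hlt k
  · simp only [hb, hβ.periodic k]
  · rw [(hself k).conjMatrix_eq]
    exact (argSelfAdjoint_transpose (b k) (b (-k)) (hlt k) (hβ.transpose_eq k).symm).symm
  · have := congrArg (fun v : unitary (Matrix (Fin N) (Fin N) ℂ) => (v : Matrix (Fin N) (Fin N) ℂ))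
      (expUnitary_argSelfAdjoint (u := b k) (hlt k))
    simp only [selfAdjoint.expUnitary_coe] at this
    exact this.symm

theorem conjMatrix_exp_neg_I_mul_smul {h : ℝ → Matrix (Fin N) (Fin N) ℂ} (hh : IsGoodFamily h)
    (x k : ℝ) : conjMatrix (exp ((-(I * (x : ℂ))) • h k)) =
      exp ((-(I * ((-x : ℝ) : ℂ))) • h (-k)) := by
  rw [conjMatrix_eq_transpose_conjTranspose, ← Matrix.exp_conjTranspose, ← Matrix.exp_transpose,
    conjTranspose_smul, transpose_smul, (hh.selfAdjoint k).eq, hh.transpose_eq]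
  congr 2
  simp

/-- The two inner `h₁` factors build the rotated family `e^{i h₂}`, and the outer factors `e^{-i
h₂/2}` cancel it. -/
theorem inv_mul_mul_eq_one_of_rotatedFamily {h₁ h₂ β : ℝ → Matrix (Fin N) (Fin N) ℂ} {k : ℝ}
    (hlog : rotatedFamily h₁ β k = exp (I • h₂ k)) :
    (exp ((-(I * ((-(1 / 2) : ℝ) : ℂ))) • h₁ k) * exp ((-(I * ((-(1 / 2) : ℝ) : ℂ))) • h₂ k))⁻¹ *
      β k * (exp ((-(I * ((1 / 2 : ℝ) : ℂ))) • h₁ k) * exp ((-(I * ((1 / 2 : ℝ) : ℂ))) • h₂ k))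
      = 1 := by
  have e1 : -(I * ((-(1 / 2) : ℝ) : ℂ)) = I / 2 := by push_cast; ring
  have e2 : -(I * ((1 / 2 : ℝ) : ℂ)) = -(I / 2) := by push_cast; ring
  rw [e1, e2]
  have hcancel : ∀ H : Matrix (Fin N) (Fin N) ℂ, (exp ((I / 2) • H))⁻¹ = exp ((-(I / 2)) • H) :=
    fun H => by rw [← Matrix.exp_neg, neg_smul]
  rw [Matrix.mul_inv_rev, hcancel, hcancel]
  calc _ = exp ((-(I / 2)) • h₂ k) * rotatedFamily h₁ β k * exp ((-(I / 2)) • h₂ k) := by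
        simp only [rotatedFamily, mul_assoc]
    _ = 1 := by
        rw [hlog, exp_smul_mul_exp_smul, exp_smul_mul_exp_smul]
        ring_nf
        simp

end GoodFamilies

/-! ### Rotation of frames. -/

section Frames

variable {D N : ℕ}

theorem sum_smul_sum_smul {E : Type*} [AddCommGroup E] [Module ℂ E]
    (A B : Matrix (Fin N) (Fin N) ℂ) (v : Fin N → E) (n : Fin N) :
    ∑ m, B m n • ∑ l, A l m • v l = ∑ l, (A * B) l n • v l := by
  simp only [Finset.smul_sum, smul_smul, Matrix.mul_apply, Finset.sum_smul]
  rw [Finset.sum_comm]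
  simp only [mul_comm]

theorem conjVec_sum_smul (a : Fin N → ℂ) (v : Fin N → EuclideanSpace ℂ (Fin D)) :
    conjVec (∑ n, a n • v n) = ∑ n, starRingEnd ℂ (a n) • conjVec (v n) := by
  ext i
  simp [conjVec]

theorem IsCSFrame.rotatedFrame
    {P : ℝ → ℝ → EuclideanSpace ℂ (Fin D) →L[ℂ] EuclideanSpace ℂ (Fin D)}
    {Ψ : Fin N → ℝ → ℝ → EuclideanSpace ℂ (Fin D)} (hΨ : IsCSFrame P Ψ)
    {u : ℝ → ℝ → Matrix (Fin N) (Fin N) ℂ}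
    (hu : ∀ p ∈ strip, u p.1 p.2 ∈ Matrix.unitaryGroup (Fin N) ℂ)
    (huc : ContinuousOn (fun p : ℝ × ℝ => u p.1 p.2) strip)
    (hup : ∀ p ∈ strip, u p.1 (p.2 + 1) = u p.1 p.2)
    (hucs : ∀ p ∈ strip, conjMatrix (u p.1 p.2) = u (-p.1) (-p.2)) :
    IsCSFrame P (rotatedFrame u Ψ) where
  orthonormal p hp := by
    rw [orthonormal_iff_ite]
    intro i j
    have h := (hΨ.orthonormal p hp).inner_sum (fun n => u p.1 p.2 n i) (fun n => u p.1 p.2 n j)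
      Finset.univ
    have h2 := congrFun (congrFun (Matrix.mem_unitaryGroup_iff'.1 (hu p hp)) i) j
    rw [Matrix.mul_apply, Matrix.one_apply] at h2
    rw [← h2]
    exact h
  span_eq p hp := by
    rw [← hΨ.span_eq p hp]
    apply le_antisymm
    · rw [Submodule.span_le]
      rintro _ ⟨m, rfl⟩
      exact Submodule.sum_mem _ fun n _ => Submodule.smul_mem _ _ (Submodule.subset_span ⟨n, rfl⟩)
    · rw [Submodule.span_le]
      rintro _ ⟨n, rfl⟩
      -- Rotating back by `u*` recovers the original vectors from the rotated ones.
      have h := sum_smul_sum_smul (u p.1 p.2) (star (u p.1 p.2)) (fun l => Ψ l p.1 p.2) n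
      rw [Matrix.mem_unitaryGroup_iff.1 (hu p hp)] at h
      simp only [Matrix.one_apply, ite_smul, one_smul, zero_smul, Finset.sum_ite_eq',
        Finset.mem_univ, if_true] at h
      rw [SetLike.mem_coe]
      dsimp only
      rw [← h]
      exact Submodule.sum_mem _ fun m _ => Submodule.smul_mem _ _ (Submodule.subset_span ⟨m, rfl⟩)
  continuousOn m := by
    have h : ∀ n, ContinuousOn (fun p : ℝ × ℝ => u p.1 p.2 n m) strip := fun n =>
      continuousOn_pi.1 (continuousOn_pi.1 huc n) m
    exact continuousOn_finsetSum _ fun n _ => (h n).smul (hΨ.continuousOn n)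
  periodic m p hp := by
    simp only [_root_.rotatedFrame, hup p hp, hΨ.periodic _ p hp]
  cs m p hp := by
    simp only [_root_.rotatedFrame, conjVec_sum_smul, hΨ.cs _ p hp, ← hucs p hp]
    rfl

theorem rotatedFrame_neg_half_eq {u : ℝ → ℝ → Matrix (Fin N) (Fin N) ℂ}
    {β : ℝ → Matrix (Fin N) (Fin N) ℂ} {Ψ : Fin N → ℝ → ℝ → EuclideanSpace ℂ (Fin D)} {k : ℝ}
    (hu : u (-(1 / 2)) k ∈ Matrix.unitaryGroup (Fin N) ℂ)
    (huβ : (u (-(1 / 2)) k)⁻¹ * β k * u (1 / 2) k = 1)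
    (hΨ : ∀ m, Ψ m (1 / 2) k = ∑ n, β k n m • Ψ n (-(1 / 2)) k) (m : Fin N) :
    rotatedFrame u Ψ m (-(1 / 2)) k = rotatedFrame u Ψ m (1 / 2) k := by
  have hdet : IsUnit (u (-(1 / 2)) k).det :=
    Matrix.isUnit_iff_isUnit_det _ |>.1 ⟨Unitary.toUnits ⟨_, hu⟩, rfl⟩
  have h : β k * u (1 / 2) k = u (-(1 / 2)) k := by
    rw [← mul_one (u (-(1 / 2)) k), ← huβ, mul_assoc, Matrix.mul_nonsing_inv_cancel_left _ _ hdet]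
  simp only [rotatedFrame, hΨ]
  rw [sum_smul_sum_smul, h]

end Frames

/-! ### Assembly of the theorem. -/

theorem mainTheorem3 {N : ℕ} (β : ℝ → Matrix (Fin N) (Fin N) ℂ) (hβ : IsMatchingFamily β) :
    ∃ (u : ℝ → ℝ → Matrix (Fin N) (Fin N) ℂ) (h₁ h₂ : ℝ → Matrix (Fin N) (Fin N) ℂ),
      (∀ p ∈ strip, u p.1 p.2 ∈ Matrix.unitaryGroup (Fin N) ℂ) ∧
      ContinuousOn (fun p : ℝ × ℝ => u p.1 p.2) strip ∧
      (∀ p ∈ strip, u p.1 (p.2 + 1) = u p.1 p.2) ∧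
      (∀ k : ℝ, (u (-(1 / 2)) k)⁻¹ * β k * u (1 / 2) k = 1) ∧
      (∀ p ∈ strip, conjMatrix (u p.1 p.2) = u (-p.1) (-p.2)) ∧
      IsGoodFamily h₁ ∧
      (∀ k : ℝ, matrixOpNorm (rotatedFamily h₁ β k - 1) ≤ 1 / 2) ∧
      IsGoodLogarithm h₂ (rotatedFamily h₁ β) ∧
      (∀ p ∈ strip, u p.1 p.2 =
        NormedSpace.exp ((-(Complex.I * (p.1 : ℂ))) • h₁ p.2) *
          NormedSpace.exp ((-(Complex.I * (p.1 : ℂ))) • h₂ p.2)) ∧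
      (∀ (D : ℕ) (P : ℝ → ℝ → EuclideanSpace ℂ (Fin D) →L[ℂ] EuclideanSpace ℂ (Fin D))
        (Ψ : Fin N → ℝ → ℝ → EuclideanSpace ℂ (Fin D)),
        (∀ p ∈ strip, IsStarProjection (P p.1 p.2)) →
        IsCSFrame P Ψ →
        (∀ m, ∀ k : ℝ, Ψ m (1 / 2) k = ∑ n, β k n m • Ψ n (-(1 / 2)) k) →
        IsCSFrame P (rotatedFrame u Ψ) ∧
          ∀ m, ∀ k : ℝ, rotatedFrame u Ψ m (-(1 / 2)) k = rotatedFrame u Ψ m (1 / 2) k) := by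
  -- For the logarithm any bound below `2` would be enough.
  obtain ⟨h₁, hh₁, hle⟩ := exists_isGoodFamily_matrixOpNorm_le hβ (ε := 1 / 2) (by norm_num)
  obtain ⟨h₂, hh₂⟩ := exists_isGoodLogarithm (rotatedFamily_isMatching hh₁ hβ)
    fun k => (hle k).trans_lt (by norm_num)
  set u : ℝ → ℝ → Matrix (Fin N) (Fin N) ℂ := fun x k =>
    NormedSpace.exp ((-(Complex.I * (x : ℂ))) • h₁ k) *
      NormedSpace.exp ((-(Complex.I * (x : ℂ))) • h₂ k) with hu_def
  have hu : ∀ x k, u x k ∈ Matrix.unitaryGroup (Fin N) ℂ := fun x k =>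
    mul_mem (exp_neg_I_mul_smul_mem_unitary (hh₁.selfAdjoint k) x)
      (exp_neg_I_mul_smul_mem_unitary (hh₂.1.selfAdjoint k) x)
  have huc : Continuous fun p : ℝ × ℝ => u p.1 p.2 := by
    have hE : ∀ h : ℝ → Matrix (Fin N) (Fin N) ℂ, Continuous h → Continuous fun p : ℝ × ℝ =>
        NormedSpace.exp ((-(Complex.I * (p.1 : ℂ))) • h p.2) := fun h hc =>
      continuous_exp_matrix.comp (by fun_prop)
    exact (hE h₁ hh₁.continuous).mul (hE h₂ hh₂.1.continuous)
  have hup : ∀ x k, u x (k + 1) = u x k := fun x k => by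
    simp only [hu_def, hh₁.periodic k, hh₂.1.periodic k]
  have huβ : ∀ k : ℝ, (u (-(1 / 2)) k)⁻¹ * β k * u (1 / 2) k = 1 := fun k =>
    inv_mul_mul_eq_one_of_rotatedFamily (hh₂.2 k)
  have hucs : ∀ x k, conjMatrix (u x k) = u (-x) (-k) := fun x k => by
    simp only [hu_def, conjMatrix_mul, conjMatrix_exp_neg_I_mul_smul hh₁,
      conjMatrix_exp_neg_I_mul_smul hh₂.1]
  refine ⟨u, h₁, h₂, fun p _ => hu _ _, huc.continuousOn, fun p _ => hup _ _, huβ,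
    fun p _ => hucs _ _, hh₁, hle, hh₂, fun p _ => rfl, fun D P Ψ _ hΨ hmatch => ⟨?_, ?_⟩⟩
  · exact hΨ.rotatedFrame (fun p _ => hu _ _) huc.continuousOn (fun p _ => hup _ _)
      fun p _ => hucs _ _
  · exact fun m k => rotatedFrame_neg_half_eq (hu _ _) (huβ k) (fun m => hmatch m k) m
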